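/- Let $a_1,a_2,\dots$ be i.i.d. complex random variables that are not almost surely equal to a constant and satisfy $\mathbb{E}|a_1|<\infty$. Let $(z_n)_{n\ge1}$ be a (deterministic) sequence of complex numbers such that (i) for Lebesgue-almost every $z\in\mathbb{C}$ there is a compact set $K_z\subset\mathbb{C}$ with $d(z,K_z)>0$ such that $z_k\in K_z$ for infinitely many indices $k$, and (ii) some point $\omega\in\mathbb{C}$ is not a limit point of $(z_n)$, that is, some neighbourhood of $\omega$ contains $z_k$ for only finitely many indices $k$. Define $L_n(z)=\sum_{k=1}^{n}\frac{a_k}{z-z_k}$. Then $\frac1n\Delta\log|L_n|\to0$ in probability in the sense of distributions. That is: whenever $L_n$ does not vanish identically, $\log|L_n|$ is locally integrable on $\mathbb{C}$, so that its distributional Laplacian is defined; $\mathbb{P}(L_n\equiv0)\to0$ as $n\to\infty$; and for every real-valued test function $f\in C_c^\infty(\mathbb{C})$, $$\Big\langle \tfrac1n\Delta\log|L_n|,\,f\Big\rangle=\frac1n\int_{\mathbb{C}}\log|L_n(z)|\,\Delta f(z)\,dm(z)\longrightarrow0\quad\text{in probability},$$ where $m$ is Lebesgue measure on $\mathbb{C}$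 and the pairing is taken to be $0$ on the event $\{L_n\equiv0\}$. -/

import Mathlib

open MeasureTheory ProbabilityTheory Filter Topology
open scoped Distributions LineDeriv

/-- The random rational function `L_n(w) = ∑_{k ≤ n} a_k / (w - z_k)` for given coefficients
`a_1, a_2, …` and points `z_1, z_2, …` (here indexed from `0`). At the finitely many points `z_k`
its value is irrelevant. -/
noncomputable def ratSum (a z : ℕ → ℂ) (n : ℕ) (w : ℂ) : ℂ :=
  ∑ k ∈ Finset.range n, a k / (w - z k)

/-- The regular distribution `f ↦ ∫ f(w) u(w) dm(w)` on the complex plane of a locally integrable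
function `u`, with `m` the Lebesgue measure (the zero distribution if `u` is not locally
integrable). -/
noncomputable def regularDistribution (u : ℂ → ℝ) : 𝓓'((⊤ : TopologicalSpace.Opens ℂ), ℝ) :=
  TestFunction.integralAgainstBilinCLM (ContinuousLinearMap.mul ℝ ℝ) volume u

/-- The Laplacian `∂²/∂x² + ∂²/∂y²` of a distribution on the complex plane. -/
noncomputable def distLaplacian (T : 𝓓'((⊤ : TopologicalSpace.Opens ℂ), ℝ)) :
    𝓓'((⊤ : TopologicalSpace.Opens ℂ), ℝ) :=
  ∂_{(1 : ℂ)} (∂_{(1 : ℂ)} T) + ∂_{Complex.I} (∂_{Complex.I} T)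

/-!
Write `L_n = ratSum a z n`. The claim reduces to `(1/n) ∫_B |log |L_n|| dm → 0` in probability for
every disc `B` centred at `0`, since the pairing with a test function `f` is
`(1/n) ∫ log |L_n| Δf dm`. The positive and the negative part of the logarithm are treated
separately.

*Positive part.* The inequality `log x ≤ log n + x / n` and the bound `∫_B dm(w) / |w - ζ| ≤ C`,
uniform in `ζ`, give `E ∫_B log⁺ |L_n| dm ≤ m(B) log n + C E|a_1| = o(n)`
(`lintegral_setLIntegral_log_norm_ratSum_le`).

*Small values are unlikely.* For almost every `w`, hypothesis (i) yields a subsequence along which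
the weights `1 / (w - z_k)` converge to a nonzero limit. The characteristic function of `L_n(w)` is
a product in which infinitely many factors stay away from modulus `1`, for almost every frequency,
because the `a_k` are not almost surely constant. Hence it tends to `0` almost everywhere, and a
Gaussian-weighted inversion inequality gives `P(|L_n(w)| < 1) → 0`
(`tendsto_measure_norm_sum_mul_lt_one`). This also handles the event `L_n ≡ 0`.

*Negative part.* Away from the `z_k`, `L_n = c ∏_{i < m} (w - ζ_i) / ∏_{k < n} (w - z_k)` with
`m ≤ n`. Hypothesis (ii) provides a point `v` at distance at least `δ > 0` from all `z_k` with
`P(|L_n(v)| ≥ 1) → 1`. Comparing the factors at `w` with those at `v` shows that on this event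
`log⁻ |L_n(w)|` is at most `O(n)` plus a sum of `m ≤ n` terms `log (1 + 2R / |w - ζ_i|)`, whose
average is uniformly integrable on `B` whatever the random zeros `ζ_i` are. So
`(1/n) ∫_B log⁻ |L_n| dm` is small once the area of `{w ∈ B : |L_n(w)| < 1}` is small
(`setLIntegral_neg_log_norm_ratSum_le`), and the expected area tends to `0` by Fubini and
dominated convergence.
-/

/-! ### Logarithms of the rational functions -/

/-- The kernel `1 / |w - ζ|` is integrable on discs of the plane, uniformly in `ζ`: it is at most `1`
outside the unit disc around `ζ`, and on that disc its integral does not depend on `ζ`. -/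
lemma exists_setLIntegral_inv_norm_sub_le (R : ℝ) : ∃ C : NNReal, ∀ ζ : ℂ,
    ∫⁻ w in Metric.ball (0 : ℂ) R, ENNReal.ofReal ‖w - ζ‖⁻¹ ≤ C := by
  have hint : IntegrableOn (fun u : ℂ => ‖u‖⁻¹) (Metric.ball 0 1) := by
    rw [integrableOn_fun_norm_addHaar (volume : Measure ℂ) (f := fun y : ℝ => y⁻¹)]
    refine (integrableOn_const (C := (1 : ℝ)) (by simp)).congr_fun (fun y hy => ?_)
      measurableSet_Ioo
    simp [Complex.finrank_real_complex, hy.1.ne']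
  have hfin : ∫⁻ u in Metric.ball (0 : ℂ) 1, ENNReal.ofReal ‖u‖⁻¹ ≠ ⊤ := hint.lintegral_lt_top.ne
  have hball : volume (Metric.ball (0 : ℂ) R) ≠ ⊤ := measure_ball_lt_top.ne
  refine ⟨(volume (Metric.ball (0 : ℂ) R)
    + ∫⁻ u in Metric.ball (0 : ℂ) 1, ENNReal.ofReal ‖u‖⁻¹).toNNReal, fun ζ => ?_⟩
  rw [ENNReal.coe_toNNReal (ENNReal.add_ne_top.2 ⟨hball, hfin⟩)]
  have hpt : ∀ u : ℂ, ENNReal.ofReal ‖u‖⁻¹ ≤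
      1 + (Metric.ball (0 : ℂ) 1).indicator (fun u => ENNReal.ofReal ‖u‖⁻¹) u := by
    intro u
    by_cases hu : u ∈ Metric.ball (0 : ℂ) 1
    · simp [Set.indicator_of_mem hu]
    · rw [Set.indicator_of_notMem hu, add_zero]
      simpa using inv_le_one_of_one_le₀ (by simpa using hu)
  calc ∫⁻ w in Metric.ball (0 : ℂ) R, ENNReal.ofReal ‖w - ζ‖⁻¹
      ≤ ∫⁻ w in Metric.ball (0 : ℂ) R,
        (1 + (Metric.ball (0 : ℂ) 1).indicator (fun u => ENNReal.ofReal ‖u‖⁻¹) (w - ζ)) :=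
        lintegral_mono fun w => hpt (w - ζ)
    _ = volume (Metric.ball (0 : ℂ) R) + ∫⁻ w in Metric.ball (0 : ℂ) R,
          (Metric.ball (0 : ℂ) 1).indicator (fun u => ENNReal.ofReal ‖u‖⁻¹) (w - ζ) := by
        rw [lintegral_add_left measurable_const]
        simp
    _ ≤ volume (Metric.ball (0 : ℂ) R) + ∫⁻ w,
          (Metric.ball (0 : ℂ) 1).indicator (fun u => ENNReal.ofReal ‖u‖⁻¹) (w - ζ) := by
        gcongr
        exact Measure.restrict_le_self
    _ = _ := by
        rw [lintegral_sub_right_eq_self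
          (fun u => (Metric.ball (0 : ℂ) 1).indicator (fun u => ENNReal.ofReal ‖u‖⁻¹) u) ζ,
          lintegral_indicator Metric.isOpen_ball.measurableSet]

lemma ae_forall_ne_of_countable {ι : Type*} [Countable ι] (z : ι → ℂ) :
    ∀ᵐ w : ℂ, ∀ k, w ≠ z k :=
  ae_all_iff.2 fun k => by simp [ae_iff]

lemma locallyIntegrable_log_norm_sub (ζ : ℂ) :
    LocallyIntegrable (fun w : ℂ => Real.log ‖w - ζ‖) volume := by
  intro x
  refine ⟨Metric.ball 0 (‖x‖ + 1), Metric.isOpen_ball.mem_nhds (by simp), ?_⟩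
  set R := ‖x‖ + 1
  obtain ⟨C, hC⟩ := exists_setLIntegral_inv_norm_sub_le R
  have hmeas : Measurable (fun w : ℂ => Real.log ‖w - ζ‖) := by fun_prop
  refine ⟨hmeas.aestronglyMeasurable, ?_⟩
  have hb : ∀ w ∈ Metric.ball (0 : ℂ) R, ‖Real.log ‖w - ζ‖‖ₑ ≤
      ENNReal.ofReal (R + ‖ζ‖) + ENNReal.ofReal ‖w - ζ‖⁻¹ := by
    intro w hw
    have hw' : ‖w‖ < R := by simpa using hw
    have h1 := norm_sub_le w ζ
    have h2 := norm_nonneg (w - ζ)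
    have h3 : (0 : ℝ) ≤ ‖w - ζ‖⁻¹ := by positivity
    rw [← ENNReal.ofReal_add (by positivity) h3, Real.enorm_eq_ofReal_abs]
    refine ENNReal.ofReal_le_ofReal (abs_le.2 ⟨?_, ?_⟩)
    · have := Real.log_le_self h3
      rw [Real.log_inv] at this
      have : 0 ≤ R := by positivity
      linarith [norm_nonneg ζ]
    · linarith [Real.log_le_self h2]
  refine lt_of_le_of_lt (setLIntegral_mono (by fun_prop) hb) ?_
  rw [lintegral_add_left measurable_const]
  refine ENNReal.add_lt_top.2 ⟨?_, (hC ζ).trans_lt (by simp)⟩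
  rw [setLIntegral_const]
  exact ENNReal.mul_lt_top (by simp) measure_ball_lt_top

lemma exists_eval_eq_prod_fin (p : Polynomial ℂ) : ∃ (m : ℕ) (ζ : Fin m → ℂ), m ≤ p.natDegree ∧
    ∀ w, p.eval w = p.leadingCoeff * ∏ i, (w - ζ i) := by
  refine ⟨p.roots.toList.length, fun i => p.roots.toList[i], ?_, fun w => ?_⟩
  · simpa using p.card_roots'
  · conv_lhs => rw [(IsAlgClosed.splits p).eq_prod_roots]
    rw [Polynomial.eval_mul, Polynomial.eval_C, Polynomial.eval_multiset_prod, Multiset.map_map]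
    congr 1
    conv_lhs => rw [← Multiset.coe_toList p.roots]
    rw [Multiset.map_coe, Multiset.prod_coe]
    have := Fin.prod_univ_fun_getElem p.roots.toList (fun ζ => w - ζ)
    simp [this]

/-- Factorization of `ratSum a z n` off the points `z k`, as a quotient whose numerator has at most
`n` linear factors. The constant `c` is `0` exactly when the function vanishes identically there. -/
lemma exists_ratSum_eq (a z : ℕ → ℂ) (n : ℕ) : ∃ (c : ℂ) (m : ℕ) (ζ : Fin m → ℂ), m ≤ n ∧
    ∀ w, (∀ k, w ≠ z k) →
      ratSum a z n w = c * (∏ i, (w - ζ i)) / ∏ k ∈ Finset.range n, (w - z k) := by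
  let p : Polynomial ℂ := ∑ k ∈ Finset.range n, Polynomial.C (a k) *
    ∏ j ∈ (Finset.range n).erase k, (Polynomial.X - Polynomial.C (z j))
  have hdeg : p.natDegree ≤ n := by
    refine Polynomial.natDegree_sum_le_of_forall_le _ _ fun k hk => ?_
    refine (Polynomial.natDegree_C_mul_le _ _).trans ?_
    rw [Polynomial.natDegree_finsetProd_X_sub_C_eq_card]
    exact (Finset.card_le_card (Finset.erase_subset _ _)).trans (by simp)
  obtain ⟨m, ζ, hm, hζ⟩ := exists_eval_eq_prod_fin p
  refine ⟨p.leadingCoeff, m, ζ, hm.trans hdeg, fun w hw => ?_⟩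
  have hne : ∀ k, w - z k ≠ 0 := fun k => sub_ne_zero.2 (hw k)
  rw [← hζ, ratSum, Polynomial.eval_finsetSum, Finset.sum_div]
  refine Finset.sum_congr rfl fun k hk => ?_
  rw [Polynomial.eval_mul, Polynomial.eval_prod, ← Finset.mul_prod_erase _ _ hk]
  have : ∏ j ∈ (Finset.range n).erase k, (w - z j) ≠ 0 := Finset.prod_ne_zero_iff.2 fun j _ => hne j
  simp only [Polynomial.eval_C, Polynomial.eval_sub, Polynomial.eval_X]
  field_simp [hne k]

lemma log_norm_mul_prod_div_prod {ι κ : Type*} {s : Finset ι} {t : Finset κ} {c : ℂ}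
    {f : ι → ℂ} {g : κ → ℂ} (hc : c ≠ 0) (hf : ∀ i ∈ s, f i ≠ 0) (hg : ∀ k ∈ t, g k ≠ 0) :
    Real.log ‖c * (∏ i ∈ s, f i) / ∏ k ∈ t, g k‖ =
      Real.log ‖c‖ + ∑ i ∈ s, Real.log ‖f i‖ - ∑ k ∈ t, Real.log ‖g k‖ := by
  have h1 : ‖∏ i ∈ s, f i‖ ≠ 0 := norm_ne_zero_iff.2 (Finset.prod_ne_zero_iff.2 hf)
  have h2 : ‖∏ k ∈ t, g k‖ ≠ 0 := norm_ne_zero_iff.2 (Finset.prod_ne_zero_iff.2 hg)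
  rw [norm_div, norm_mul, Real.log_div (mul_ne_zero (norm_ne_zero_iff.2 hc) h1) h2,
    Real.log_mul (norm_ne_zero_iff.2 hc) h1, norm_prod, norm_prod, Real.log_prod, Real.log_prod]
  · exact fun k hk => norm_ne_zero_iff.2 (hg k hk)
  · exact fun i hi => norm_ne_zero_iff.2 (hf i hi)

/-- No nonvanishing assumption is needed: for the zero function, `Real.log 0 = 0`. -/
lemma locallyIntegrable_log_norm_ratSum (a z : ℕ → ℂ) (n : ℕ) :
    LocallyIntegrable (fun w : ℂ => Real.log ‖ratSum a z n w‖) volume := by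
  obtain ⟨c, m, ζ, -, h⟩ := exists_ratSum_eq a z n
  by_cases hc : c = 0
  · refine (locallyIntegrable_zero (X := ℂ) (ε'' := ℝ) (μ := volume)).congr ?_
    filter_upwards [ae_forall_ne_of_countable z] with w hw
    simp [h w hw, hc]
  · have hl : LocallyIntegrable (fun w : ℂ => Real.log ‖c‖ + ∑ i, Real.log ‖w - ζ i‖ -
        ∑ k ∈ Finset.range n, Real.log ‖w - z k‖) volume :=
      ((locallyIntegrable_const _).add (locallyIntegrable_finsetSum _
        fun i _ => locallyIntegrable_log_norm_sub (ζ i))).sub (locallyIntegrable_finsetSum _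
        fun k _ => locallyIntegrable_log_norm_sub (z k))
    refine hl.congr ?_
    filter_upwards [ae_forall_ne_of_countable z, ae_forall_ne_of_countable ζ] with w hw hw'
    rw [h w hw, log_norm_mul_prod_div_prod hc (fun i _ => sub_ne_zero.2 (hw' i))
      (fun k _ => sub_ne_zero.2 (hw k))]

lemma ratSum_eq_zero_of_ae_eq_zero {a z : ℕ → ℂ} {n : ℕ} (h0 : ratSum a z n =ᵐ[volume] 0) {w : ℂ}
    (hw : ∀ k, w ≠ z k) : ratSum a z n w = 0 := by
  obtain ⟨c, m, ζ, -, h⟩ := exists_ratSum_eq a z n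
  suffices hc : c = 0 by simp [h w hw, hc]
  obtain ⟨v, ⟨hv, hvz⟩, hvζ⟩ :=
    ((h0.and (ae_forall_ne_of_countable z)).and (ae_forall_ne_of_countable ζ)).exists
  rw [h v hvz, Pi.zero_apply, div_eq_zero_iff, mul_eq_zero] at hv
  rcases hv with (hv | hv) | hv
  · exact hv
  · obtain ⟨i, -, hi⟩ := Finset.prod_eq_zero_iff.1 hv
    exact absurd (sub_eq_zero.1 hi) (hvζ i)
  · obtain ⟨i, -, hi⟩ := Finset.prod_eq_zero_iff.1 hv
    exact absurd (sub_eq_zero.1 hi) (hvz i)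

lemma log_norm_sub_sub_log_norm_sub_le {v w ζ : ℂ} {r : ℝ} (hvw : ‖v - w‖ ≤ r) (hv : v ≠ ζ)
    (hw : w ≠ ζ) : Real.log ‖v - ζ‖ - Real.log ‖w - ζ‖ ≤ Real.log (1 + r * ‖w - ζ‖⁻¹) := by
  have h1 : 0 < ‖v - ζ‖ := norm_pos_iff.2 (sub_ne_zero.2 hv)
  have h2 : 0 < ‖w - ζ‖ := norm_pos_iff.2 (sub_ne_zero.2 hw)
  rw [← Real.log_div h1.ne' h2.ne']
  refine Real.log_le_log (by positivity) ?_
  rw [div_le_iff₀ h2, add_mul, one_mul, mul_assoc, inv_mul_cancel₀ h2.ne', mul_one]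
  calc ‖v - ζ‖ = ‖(v - w) + (w - ζ)‖ := by ring_nf
    _ ≤ ‖v - w‖ + ‖w - ζ‖ := norm_add_le _ _
    _ ≤ _ := by linarith

/-- A linear bound on `log (1 + x)` with small slope `1 / M`. It replaces uniform integrability of
the logarithm: integrated over a set, it gives `M` times the measure plus a small multiple of the
integral of `x`. -/
lemma log_one_add_le_add_div {x M : ℝ} (hx : 0 ≤ x) (hM : 1 ≤ M) :
    Real.log (1 + x) ≤ M + x / M := by
  have hM0 : 0 < M := by linarith
  have h1 : Real.log (1 + x) = Real.log M + Real.log ((1 + x) / M) := by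
    rw [Real.log_div (by positivity) hM0.ne']; ring
  have h2 := Real.log_le_sub_one_of_pos hM0
  have h3 := Real.log_le_sub_one_of_pos (show 0 < (1 + x) / M by positivity)
  have h4 : (1 + x) / M ≤ 1 + x / M := by
    rw [add_div]; gcongr; exact (div_le_one hM0).2 hM
  linarith

/-- Comparison of `log |L_n(w)|` with `log |L_n(v)| ≥ 0`, factor by factor. A zero `ζ i`
contributes at most `log (1 + 2R / |w - ζ i|)` and a pole at most `log (1 + 2R / δ)`. -/
lemma neg_log_norm_ratSum_le {a z : ℕ → ℂ} {n : ℕ} {c : ℂ} {m : ℕ} {ζ : Fin m → ℂ} (hm : m ≤ n)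
    (h : ∀ w, (∀ k, w ≠ z k) →
      ratSum a z n w = c * (∏ i, (w - ζ i)) / ∏ k ∈ Finset.range n, (w - z k))
    {v w : ℂ} {R δ M : ℝ} (hδ : 0 < δ) (hM : 1 ≤ M) (hvz : ∀ k, δ ≤ ‖v - z k‖)
    (hv : ‖v‖ ≤ R) (hw : ‖w‖ ≤ R) (hone : 1 ≤ ‖ratSum a z n v‖) (hwz : ∀ k, w ≠ z k)
    (hwζ : ∀ i, w ≠ ζ i) :
    -Real.log ‖ratSum a z n w‖ ≤ n * (2 * R / δ + M) + ∑ i, 2 * R / M * ‖w - ζ i‖⁻¹ := by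
  have hR : 0 ≤ R := (norm_nonneg v).trans hv
  have hvz' : ∀ k, v ≠ z k := fun k hk => by
    have := hvz k
    rw [hk, sub_self, norm_zero] at this
    linarith
  have hne : c * ∏ i, (v - ζ i) ≠ 0 := fun h0 => by
    rw [h v hvz', h0] at hone
    norm_num at hone
  obtain ⟨hc, hprod⟩ := mul_ne_zero_iff.1 hne
  have hvζ : ∀ i, v ≠ ζ i := fun i => sub_ne_zero.1 (Finset.prod_ne_zero_iff.1 hprod i (by simp))
  have hlogv := Real.log_nonneg hone
  have hvw : ‖v - w‖ ≤ 2 * R := (norm_sub_le v w).trans (by linarith)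
  have hwv : ‖w - v‖ ≤ 2 * R := by rwa [norm_sub_rev]
  rw [h v hvz', log_norm_mul_prod_div_prod hc (fun i _ => sub_ne_zero.2 (hvζ i))
      (fun k _ => sub_ne_zero.2 (hvz' k))] at hlogv
  rw [h w hwz, log_norm_mul_prod_div_prod hc (fun i _ => sub_ne_zero.2 (hwζ i))
      (fun k _ => sub_ne_zero.2 (hwz k))]
  have hz : ∑ k ∈ Finset.range n, Real.log ‖w - z k‖ - ∑ k ∈ Finset.range n, Real.log ‖v - z k‖ ≤
      n * (2 * R / δ) := by
    rw [← Finset.sum_sub_distrib]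
    refine (Finset.sum_le_card_nsmul _ _ (2 * R / δ) fun k _ => ?_).trans (by simp)
    refine (log_norm_sub_sub_log_norm_sub_le hwv (hwz k) (hvz' k)).trans ?_
    have h1 : 0 ≤ 2 * R * ‖v - z k‖⁻¹ := by positivity
    have h2 : 2 * R * ‖v - z k‖⁻¹ ≤ 2 * R / δ := by
      rw [div_eq_mul_inv]; gcongr; exact hvz k
    linarith [Real.log_le_sub_one_of_pos (show 0 < 1 + 2 * R * ‖v - z k‖⁻¹ by linarith)]
  have hζ : ∑ i, Real.log ‖v - ζ i‖ - ∑ i, Real.log ‖w - ζ i‖ ≤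
      n * M + ∑ i, 2 * R / M * ‖w - ζ i‖⁻¹ := by
    have hsum : ∑ i, Real.log ‖v - ζ i‖ - ∑ i, Real.log ‖w - ζ i‖ ≤
        ∑ i, (M + 2 * R / M * ‖w - ζ i‖⁻¹) := by
      rw [← Finset.sum_sub_distrib]
      refine Finset.sum_le_sum fun i _ => ?_
      refine (log_norm_sub_sub_log_norm_sub_le hvw (hvζ i) (hwζ i)).trans ?_
      refine (log_one_add_le_add_div (by positivity) hM).trans (le_of_eq ?_)
      ring
    rw [Finset.sum_add_distrib] at hsum
    have hmn : (m : ℝ) * M ≤ n * M := by gcongr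
    simp only [Finset.sum_const, Finset.card_univ, Fintype.card_fin, nsmul_eq_mul] at hsum
    linarith
  linarith

/-- Bound on `∫_A log⁻ |L_n|` by `n` times a quantity that is small when `M` is large and the area
of `A` is then small, under the sole assumption that `|L_n(v)| ≥ 1` at one point `v` away from the
poles. It does not involve the zeros of `L_n`. -/
lemma setLIntegral_neg_log_norm_ratSum_le {a z : ℕ → ℂ} {n : ℕ} {v : ℂ} {R δ M : ℝ} {C : NNReal}
    (hC : ∀ ζ : ℂ, ∫⁻ w in Metric.ball (0 : ℂ) R, ENNReal.ofReal ‖w - ζ‖⁻¹ ≤ C)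
    (hδ : 0 < δ) (hM : 1 ≤ M) (hvz : ∀ k, δ ≤ ‖v - z k‖)
    (hv : ‖v‖ ≤ R) (hone : 1 ≤ ‖ratSum a z n v‖) {A : Set ℂ}
    (hAR : A ⊆ Metric.ball 0 R) :
    ∫⁻ w in A, ENNReal.ofReal (-Real.log ‖ratSum a z n w‖) ≤
      n * (ENNReal.ofReal (2 * R / δ + M) * volume A + ENNReal.ofReal (2 * R / M) * C) := by
  obtain ⟨c, m, ζ, hm, h⟩ := exists_ratSum_eq a z n
  have hR : 0 ≤ R := (norm_nonneg v).trans hv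
  calc ∫⁻ w in A, ENNReal.ofReal (-Real.log ‖ratSum a z n w‖)
      ≤ ∫⁻ w in A, (n * ENNReal.ofReal (2 * R / δ + M) +
          ∑ i, ENNReal.ofReal (2 * R / M) * ENNReal.ofReal ‖w - ζ i‖⁻¹) := by
        refine setLIntegral_mono_ae (by fun_prop) ?_
        filter_upwards [ae_forall_ne_of_countable z, ae_forall_ne_of_countable ζ] with w hw hw' hwA
        have hwR : ‖w‖ ≤ R := (mem_ball_zero_iff.1 (hAR hwA)).le
        refine (ENNReal.ofReal_le_ofReal
          (neg_log_norm_ratSum_le hm h hδ hM hvz hv hwR hone hw hw')).trans (le_of_eq ?_)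
        rw [ENNReal.ofReal_add (by positivity) (by positivity), ENNReal.ofReal_mul (by positivity),
          ENNReal.ofReal_sum_of_nonneg (fun i _ => by positivity), ENNReal.ofReal_natCast]
        simp_rw [ENNReal.ofReal_mul (show 0 ≤ 2 * R / M by positivity)]
    _ = n * ENNReal.ofReal (2 * R / δ + M) * volume A + ∑ i, ENNReal.ofReal (2 * R / M) *
          ∫⁻ w in A, ENNReal.ofReal ‖w - ζ i‖⁻¹ := by
        rw [lintegral_add_left measurable_const, setLIntegral_const,
          lintegral_finsetSum _ (fun i _ => by fun_prop)]
        simp_rw [lintegral_const_mul' _ _ ENNReal.ofReal_ne_top]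
    _ ≤ n * ENNReal.ofReal (2 * R / δ + M) * volume A + ∑ _i : Fin m,
          ENNReal.ofReal (2 * R / M) * C := by
        gcongr with i
        exact (lintegral_mono_set hAR).trans (hC (ζ i))
    _ ≤ n * ENNReal.ofReal (2 * R / δ + M) * volume A + n * (ENNReal.ofReal (2 * R / M) * C) := by
        simp only [Finset.sum_const, Finset.card_univ, Fintype.card_fin, nsmul_eq_mul]
        gcongr
    _ = _ := by ring

/-! ### Anti-concentration of weighted sums -/

lemma volume_setOf_inner_eq {u : ℂ} (hu : u ≠ 0) (r : ℝ) :
    volume {t : ℂ | inner ℝ u t = r} = 0 := by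
  rcases Set.eq_empty_or_nonempty {t : ℂ | inner ℝ u t = r} with h | ⟨t₀, ht₀⟩
  · rw [h, measure_empty]
  · let s : Submodule ℝ ℂ := LinearMap.ker (innerSL ℝ u).toLinearMap
    have hs : s ≠ ⊤ := fun h => hu <| by
      have : u ∈ s := h ▸ Submodule.mem_top
      simpa [s] using this
    have h0 := Measure.addHaar_submodule volume s hs
    rw [← measure_preimage_add_right volume (-t₀)] at h0
    refine measure_mono_null (fun t ht => ?_) h0
    simp only [Set.mem_ofPred_eq] at ht ht₀
    simp [s, inner_add_right, inner_neg_right, ht, ht₀]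

/-- Equality `|charFun μ t| = 1` makes `x ↦ exp (i ⟪x, t⟫)` constant on the support of `μ`. Two
distinct support points `x`, `y` then force `⟪x - y, t⟫ ∈ 2πℤ`, so `t` lies in a countable union
of lines. -/
lemma ae_norm_charFun_lt_one {μ : Measure ℂ} [IsProbabilityMeasure μ]
    (hμ : ¬ ∃ c : ℂ, ∀ᵐ x ∂μ, x = c) : ∀ᵐ t : ℂ, ‖charFun μ t‖ < 1 := by
  obtain ⟨x, hx⟩ : μ.support.Nonempty := Measure.nonempty_support (IsProbabilityMeasure.ne_zero μ)
  obtain ⟨y, hy, hxy⟩ : ∃ y ∈ μ.support, y ≠ x := by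
    by_contra! h
    exact hμ ⟨x, Filter.mem_of_superset Measure.support_mem_ae h⟩
  have hnull : ∀ᵐ t : ℂ, ∀ n : ℤ, inner ℝ (x - y) t ≠ n * (2 * Real.pi) :=
    ae_all_iff.2 fun n => by
      simpa [ae_iff] using volume_setOf_inner_eq (sub_ne_zero.2 hxy.symm) (n * (2 * Real.pi))
  filter_upwards [hnull] with t ht
  rcases ae_eq_const_or_norm_integral_lt_of_norm_le_const (μ := μ) (C := 1)
    (f := fun x : ℂ => Complex.exp ((inner ℝ x t : ℝ) * Complex.I))
    (ae_of_all _ fun x => (Complex.norm_exp_ofReal_mul_I _).le) with h | h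
  · exfalso
    have hsupp := Measure.support_subset_of_isClosed
      (isClosed_eq (f := fun x : ℂ => Complex.exp ((inner ℝ x t : ℝ) * Complex.I))
        (g := fun _ => ⨍ x, Complex.exp ((inner ℝ x t : ℝ) * Complex.I) ∂μ) (by fun_prop)
        (by fun_prop)) h
    obtain ⟨n, hn⟩ := Complex.exp_eq_exp_iff_exists_int.1 ((hsupp hx).trans (hsupp hy).symm)
    refine ht n ?_
    have h2 : ((inner ℝ x t : ℝ) : ℂ) = (inner ℝ y t : ℝ) + n * (2 * Real.pi) := by
      apply mul_right_cancel₀ Complex.I_ne_zero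
      rw [hn]; ring
    have h3 : (inner ℝ x t : ℝ) = inner ℝ y t + n * (2 * Real.pi) := by exact_mod_cast h2
    rw [inner_sub_left, h3]; ring
  · simpa [charFun_apply] using h

lemma integral_exp_neg_norm_sq_mul_exp_inner (x : ℂ) :
    ∫ t : ℂ, (Real.exp (-‖t‖ ^ 2) : ℂ) * Complex.exp ((inner ℝ x t : ℝ) * Complex.I) =
      (Real.pi * Real.exp (-‖x‖ ^ 2 / 4) : ℝ) := by
  have h := GaussianFourier.integral_cexp_neg_mul_sq_norm_add (V := ℂ) (b := 1) (by simp)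
    Complex.I x
  rw [Complex.finrank_real_complex] at h
  push_cast
  convert h using 1
  · refine integral_congr_ae (ae_of_all _ fun t => ?_)
    simp only
    rw [← Complex.exp_add]
    ring_nf
  · simp

lemma integrable_exp_neg_norm_sq : Integrable (fun t : ℂ => Real.exp (-‖t‖ ^ 2)) := by
  have h := GaussianFourier.integrable_cexp_neg_mul_sq_norm_add (V := ℂ) (b := 1) (by simp) 0 0
  refine h.norm.congr (ae_of_all _ fun t => ?_)
  simp only [Complex.norm_exp]
  congr 1
  simp [← Complex.ofReal_pow]

/-- A form of Esseen's concentration inequality, from the fact that the Fourier transform of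
`exp (-|t|²)` is at least `1` on the unit disc. -/
lemma measure_ball_zero_one_le_lintegral_charFun (μ : Measure ℂ) [IsProbabilityMeasure μ] :
    μ (Metric.ball 0 1) ≤ ∫⁻ t : ℂ, ENNReal.ofReal (Real.exp (-‖t‖ ^ 2) * ‖charFun μ t‖) := by
  have hconst : (1 : ℝ) ≤ Real.pi * Real.exp (-1 / 4) := by
    have h1 := Real.add_one_le_exp (-1 / 4 : ℝ)
    nlinarith [Real.pi_gt_three]
  have hint : Integrable (Function.uncurry fun (x t : ℂ) =>
      (Real.exp (-‖t‖ ^ 2) : ℂ) * Complex.exp ((inner ℝ x t : ℝ) * Complex.I))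
      (μ.prod volume) := by
    have h1 : Integrable (fun p : ℂ × ℂ => ((Real.exp (-‖p.2‖ ^ 2) : ℝ) : ℂ)) (μ.prod volume) :=
      (integrable_exp_neg_norm_sq.comp_snd μ).ofReal
    refine h1.mono (Continuous.aestronglyMeasurable (by fun_prop)) (ae_of_all _ fun p => ?_)
    simp only [Function.uncurry, norm_mul, Complex.norm_exp_ofReal_mul_I, mul_one, le_refl]
  have hswap : ∫ t : ℂ, (Real.exp (-‖t‖ ^ 2) : ℂ) * charFun μ t =
      ((∫ x, Real.pi * Real.exp (-‖x‖ ^ 2 / 4) ∂μ : ℝ) : ℂ) := by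
    simp_rw [charFun_apply, ← integral_const_mul]
    rw [← integral_integral_swap hint, ← integral_complex_ofReal]
    simp_rw [integral_exp_neg_norm_sq_mul_exp_inner]
  have hgint : Integrable (fun x : ℂ => Real.pi * Real.exp (-‖x‖ ^ 2 / 4)) μ := by
    refine Integrable.of_bound (Continuous.aestronglyMeasurable (by fun_prop)) Real.pi
      (ae_of_all _ fun x => ?_)
    rw [Real.norm_of_nonneg (by positivity)]
    exact mul_le_of_le_one_right Real.pi_pos.le (Real.exp_le_one_iff.2 (by
      have := sq_nonneg ‖x‖; linarith))
  calc μ (Metric.ball 0 1)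
      = ∫⁻ x, (Metric.ball (0 : ℂ) 1).indicator 1 x ∂μ := by
        rw [lintegral_indicator_one Metric.isOpen_ball.measurableSet]
    _ ≤ ∫⁻ x, ENNReal.ofReal (Real.pi * Real.exp (-‖x‖ ^ 2 / 4)) ∂μ := by
        refine lintegral_mono fun x => ?_
        by_cases hx : x ∈ Metric.ball (0 : ℂ) 1
        · rw [Set.indicator_of_mem hx, Pi.one_apply, ENNReal.one_le_ofReal]
          refine hconst.trans ?_
          have hx1 : ‖x‖ < 1 := by simpa using hx
          have hx2 : ‖x‖ ^ 2 ≤ 1 := by nlinarith [norm_nonneg x]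
          gcongr
        · simp [Set.indicator_of_notMem hx]
    _ = ENNReal.ofReal (∫ x, Real.pi * Real.exp (-‖x‖ ^ 2 / 4) ∂μ) := by
        rw [ofReal_integral_eq_lintegral_ofReal hgint (ae_of_all _ fun x => by positivity)]
    _ = ENNReal.ofReal ‖∫ t : ℂ, (Real.exp (-‖t‖ ^ 2) : ℂ) * charFun μ t‖ := by
        rw [hswap, Complex.norm_real, Real.norm_of_nonneg
          (integral_nonneg fun x => by positivity)]
    _ ≤ ∫⁻ t : ℂ, ‖(Real.exp (-‖t‖ ^ 2) : ℂ) * charFun μ t‖ₑ := by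
        rw [ofReal_norm]
        exact enorm_integral_le_lintegral_enorm _
    _ = _ := by
        refine lintegral_congr fun t => ?_
        rw [← ofReal_norm, norm_mul, Complex.norm_real, Real.norm_of_nonneg (by positivity)]

lemma tendsto_prod_range_zero_of_frequently_le {x : ℕ → ℝ} {ρ : ℝ} (h0 : ∀ k, 0 ≤ x k)
    (h1 : ∀ k, x k ≤ 1) (hρ : ρ < 1) (hx : ∃ᶠ k in atTop, x k ≤ ρ) :
    Tendsto (fun n => ∏ k ∈ Finset.range n, x k) atTop (𝓝 0) := by
  set p : ℕ → ℝ := fun n => ∏ k ∈ Finset.range n, x k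
  have hp0 : ∀ n, 0 ≤ p n := fun n => Finset.prod_nonneg fun k _ => h0 k
  have hsucc : ∀ n, p (n + 1) = p n * x n := fun n => Finset.prod_range_succ _ _
  have hanti : Antitone p := antitone_nat_of_succ_le fun n => by
    rw [hsucc]; exact mul_le_of_le_one_right (hp0 n) (h1 n)
  have hlim := tendsto_atTop_ciInf hanti ⟨0, by rintro _ ⟨n, rfl⟩; exact hp0 n⟩
  set l := ⨅ n, p n
  have hl0 : 0 ≤ l := ge_of_tendsto' hlim hp0
  -- Infinitely often `p (k + 1) ≤ ρ * p k`, so the limit satisfies `l ≤ ρ * l`.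
  have hle : l - ρ * l ≤ 0 := by
    refine le_of_tendsto_of_frequently
      (((tendsto_add_atTop_iff_nat 1).2 hlim).sub (hlim.const_mul ρ)) (hx.mono fun k hk => ?_)
    rw [hsucc]
    nlinarith [hp0 k]
  have hl : l = 0 := by nlinarith
  rwa [hl] at hlim

lemma charFun_map_const_mul {Ω : Type*} [MeasurableSpace Ω] {P : Measure Ω} {X : Ω → ℂ}
    (hX : Measurable X) (c t : ℂ) :
    charFun (P.map fun ω => c * X ω) t = charFun (P.map X) (starRingEnd ℂ c * t) := by
  rw [charFun_apply, charFun_apply, integral_map (by fun_prop)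
    (Continuous.aestronglyMeasurable (by fun_prop)), integral_map (by fun_prop)
    (Continuous.aestronglyMeasurable (by fun_prop))]
  refine integral_congr_ae (ae_of_all _ fun ω => ?_)
  have : inner ℝ (c * X ω) t = inner ℝ (X ω) (starRingEnd ℂ c * t) := by
    simp [Complex.inner]; ring
  simp only [this]

/-- Anti-concentration: if the weights `b k` accumulate at a nonzero value, the sums `∑ b k * a k`
of weighted i.i.d. nondegenerate variables leave the unit disc with probability tending to `1`. -/
lemma tendsto_measure_norm_sum_mul_lt_one {Ω : Type*} [MeasurableSpace Ω] {P : Measure Ω}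
    [IsProbabilityMeasure P] {a : ℕ → Ω → ℂ} (ha_meas : ∀ k, Measurable (a k))
    (ha_indep : iIndepFun a P) (ha_ident : ∀ k, IdentDistrib (a k) (a 0) P P)
    (ha_nondeg : ¬ ∃ c : ℂ, ∀ᵐ ω ∂P, a 0 ω = c) {b : ℕ → ℂ} {φ : ℕ → ℕ} {c : ℂ}
    (hφ : StrictMono φ) (hc : c ≠ 0) (hb : Tendsto (b ∘ φ) atTop (𝓝 c)) :
    Tendsto (fun n => P {ω | ‖∑ k ∈ Finset.range n, b k * a k ω‖ < 1}) atTop (𝓝 0) := by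
  set μ := P.map (a 0) with hμ
  have : IsProbabilityMeasure μ := Measure.isProbabilityMeasure_map (ha_meas 0).aemeasurable
  have hmeas : ∀ n, Measurable fun ω => ∑ k ∈ Finset.range n, b k * a k ω := fun n => by fun_prop
  have hchar : ∀ n t, ‖charFun (P.map fun ω => ∑ k ∈ Finset.range n, b k * a k ω) t‖ =
      ∏ k ∈ Finset.range n, ‖charFun μ (starRingEnd ℂ (b k) * t)‖ := by
    intro n t
    have hind : iIndepFun (fun k ω => b k * a k ω) P :=
      ha_indep.comp (fun k x => b k * x) (fun k => by fun_prop)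
    rw [iIndepFun.charFun_map_fun_finsetSum_eq_prod (fun k _ => by fun_prop) (hind.restrict _),
      Finset.prod_apply, norm_prod]
    refine Finset.prod_congr rfl fun k _ => ?_
    rw [charFun_map_const_mul (ha_meas k), (ha_ident k).map_eq]
  have hlt : ∀ᵐ t : ℂ, ‖charFun μ (starRingEnd ℂ c * t)‖ < 1 := by
    have hca : Measurable fun ω => c * a 0 ω := by fun_prop
    have : IsProbabilityMeasure (P.map fun ω => c * a 0 ω) :=
      Measure.isProbabilityMeasure_map hca.aemeasurable
    -- The left side is the characteristic function of `c * a 0`, which is nondegenerate as `c ≠ 0`.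
    simp_rw [hμ, ← charFun_map_const_mul (ha_meas 0)]
    refine ae_norm_charFun_lt_one ?_
    rintro ⟨d, hd⟩
    refine ha_nondeg ⟨c⁻¹ * d, ?_⟩
    filter_upwards [ae_of_ae_map hca.aemeasurable hd] with ω hω
    rw [← hω, inv_mul_cancel_left₀ hc]
  have hprod : ∀ᵐ t : ℂ, Tendsto (fun n => ∏ k ∈ Finset.range n,
      ‖charFun μ (starRingEnd ℂ (b k) * t)‖) atTop (𝓝 0) := by
    filter_upwards [hlt] with t ht
    obtain ⟨ρ, hρ1, hρ2⟩ := exists_between ht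
    refine tendsto_prod_range_zero_of_frequently_le (fun _ => norm_nonneg _)
      (fun _ => norm_charFun_le_one _) hρ2 ?_
    have hcont : Continuous fun d : ℂ => ‖charFun μ (starRingEnd ℂ d * t)‖ :=
      ((continuous_charFun).comp (by fun_prop)).norm
    have hev := ((hcont.tendsto c).comp hb).eventually_le_const hρ1
    exact hφ.tendsto_atTop.frequently hev.frequently
  have hbound : ∀ n, P {ω | ‖∑ k ∈ Finset.range n, b k * a k ω‖ < 1} ≤
      ∫⁻ t : ℂ, ENNReal.ofReal (Real.exp (-‖t‖ ^ 2) *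
        ∏ k ∈ Finset.range n, ‖charFun μ (starRingEnd ℂ (b k) * t)‖) := by
    intro n
    have : IsProbabilityMeasure (P.map fun ω => ∑ k ∈ Finset.range n, b k * a k ω) :=
      Measure.isProbabilityMeasure_map (hmeas n).aemeasurable
    have h := measure_ball_zero_one_le_lintegral_charFun
      (P.map fun ω => ∑ k ∈ Finset.range n, b k * a k ω)
    rw [Measure.map_apply (hmeas n) Metric.isOpen_ball.measurableSet] at h
    simp_rw [hchar] at h
    convert h using 2
    ext ω
    simp
  refine tendsto_of_tendsto_of_tendsto_of_le_of_le tendsto_const_nhds ?_ (fun _ => zero_le)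
    hbound
  have hdom := tendsto_lintegral_of_dominated_convergence (μ := (volume : Measure ℂ))
    (F := fun n t => ENNReal.ofReal (Real.exp (-‖t‖ ^ 2) *
        ∏ k ∈ Finset.range n, ‖charFun μ (starRingEnd ℂ (b k) * t)‖)) (f := fun _ => 0)
    (fun t => ENNReal.ofReal (Real.exp (-‖t‖ ^ 2))) ?_ ?_ ?_ ?_
  · simpa using hdom
  · intro n
    have : Measurable (charFun μ) := measurable_charFun
    fun_prop
  · intro n
    refine ae_of_all _ fun t => ENNReal.ofReal_le_ofReal ?_
    exact mul_le_of_le_one_right (by positivity)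
      (Finset.prod_le_one (fun _ _ => norm_nonneg _) fun _ _ => norm_charFun_le_one _)
  · exact integrable_exp_neg_norm_sq.lintegral_lt_top.ne
  · filter_upwards [hprod] with t ht
    have := ENNReal.tendsto_ofReal (ht.const_mul (Real.exp (-‖t‖ ^ 2)))
    simpa using this

lemma exists_subseq_tendsto_inv_sub {z : ℕ → ℂ} {w : ℂ} {K : Set ℂ} (hK : IsCompact K)
    (hw : 0 < Metric.infDist w K) (hinf : {k : ℕ | z k ∈ K}.Infinite) :
    ∃ (φ : ℕ → ℕ) (c : ℂ), StrictMono φ ∧ c ≠ 0 ∧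
      Tendsto ((fun k => (w - z k)⁻¹) ∘ φ) atTop (𝓝 c) := by
  obtain ⟨ζ, hζ, φ, hφ, hlim⟩ := hK.tendsto_subseq' (Nat.frequently_atTop_iff_infinite.2 hinf)
  have hne : w - ζ ≠ 0 := by
    intro h
    rw [sub_eq_zero.1 h, Metric.infDist_zero_of_mem hζ] at hw
    exact lt_irrefl _ hw
  exact ⟨φ, (w - ζ)⁻¹, hφ, inv_ne_zero hne, (tendsto_const_nhds.sub hlim).inv₀ hne⟩

/-! ### Convergence in probability -/

lemma measurable_uncurry_ratSum {Ω : Type*} [MeasurableSpace Ω] {a : ℕ → Ω → ℂ}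
    (ha_meas : ∀ k, Measurable (a k)) (z : ℕ → ℂ) (n : ℕ) :
    Measurable fun p : Ω × ℂ => ratSum (fun k => a k p.1) z n p.2 := by
  unfold ratSum
  fun_prop

lemma ae_tendsto_measure_norm_ratSum_lt_one {Ω : Type*} [MeasurableSpace Ω] {P : Measure Ω}
    [IsProbabilityMeasure P] {a : ℕ → Ω → ℂ} {z : ℕ → ℂ} (ha_meas : ∀ k, Measurable (a k))
    (ha_indep : iIndepFun a P) (ha_ident : ∀ k, IdentDistrib (a k) (a 0) P P)
    (ha_nondeg : ¬ ∃ c : ℂ, ∀ᵐ ω ∂P, a 0 ω = c)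
    (hz_compact : ∀ᵐ w : ℂ, ∃ K : Set ℂ,
      IsCompact K ∧ 0 < Metric.infDist w K ∧ {k : ℕ | z k ∈ K}.Infinite) :
    ∀ᵐ w : ℂ, Tendsto (fun n => P {ω | ‖ratSum (fun k => a k ω) z n w‖ < 1}) atTop (𝓝 0) := by
  filter_upwards [hz_compact] with w ⟨K, hK, hw, hinf⟩
  obtain ⟨φ, c, hφ, hc, hlim⟩ := exists_subseq_tendsto_inv_sub hK hw hinf
  refine (tendsto_measure_norm_sum_mul_lt_one ha_meas ha_indep ha_ident ha_nondeg hφ hc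
    hlim).congr fun n => ?_
  simp only [ratSum, div_eq_inv_mul]

lemma tendsto_lintegral_volume_norm_ratSum_lt_one {Ω : Type*} [MeasurableSpace Ω] {P : Measure Ω}
    [IsProbabilityMeasure P] {a : ℕ → Ω → ℂ} {z : ℕ → ℂ} (ha_meas : ∀ k, Measurable (a k))
    (hsmall : ∀ᵐ w : ℂ,
      Tendsto (fun n => P {ω | ‖ratSum (fun k => a k ω) z n w‖ < 1}) atTop (𝓝 0)) (R : ℝ) :
    Tendsto (fun n => ∫⁻ ω, volume (Metric.ball (0 : ℂ) R ∩
      {w | ‖ratSum (fun k => a k ω) z n w‖ < 1}) ∂P) atTop (𝓝 0) := by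
  have hS : ∀ n, MeasurableSet {p : Ω × ℂ | ‖ratSum (fun k => a k p.1) z n p.2‖ < 1} := fun n =>
    measurableSet_lt (measurable_uncurry_ratSum ha_meas z n).norm measurable_const
  have heq : ∀ n, ∫⁻ ω, volume (Metric.ball (0 : ℂ) R ∩
      {w | ‖ratSum (fun k => a k ω) z n w‖ < 1}) ∂P =
      ∫⁻ w in Metric.ball (0 : ℂ) R, P {ω | ‖ratSum (fun k => a k ω) z n w‖ < 1} := by
    intro n
    have h1 := Measure.prod_apply (μ := P) (ν := volume.restrict (Metric.ball (0 : ℂ) R)) (hS n)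
    have h2 := Measure.prod_apply_symm (μ := P) (ν := volume.restrict (Metric.ball (0 : ℂ) R))
      (hS n)
    rw [h1] at h2
    refine Eq.trans (lintegral_congr fun ω => ?_) h2
    rw [Measure.restrict_apply (measurable_prodMk_left (hS n)), Set.inter_comm]
    rfl
  simp_rw [heq]
  have := tendsto_lintegral_of_dominated_convergence
    (μ := (volume : Measure ℂ).restrict (Metric.ball 0 R))
    (F := fun n w => P {ω | ‖ratSum (fun k => a k ω) z n w‖ < 1}) (f := fun _ => 0)
    (fun _ => 1) (fun n => measurable_measure_prodMk_right (hS n))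
    (fun n => ae_of_all _ fun w => prob_le_one) ?_ (ae_restrict_of_ae hsmall)
  · simpa using this
  · simpa using (measure_ball_lt_top (μ := (volume : Measure ℂ)) (x := 0) (r := R)).ne

/-- Bound on `E ∫_B log⁺ |L_n|`; note that `ENNReal.ofReal` truncates the logarithm at `0`. -/
lemma lintegral_setLIntegral_log_norm_ratSum_le {Ω : Type*} [MeasurableSpace Ω] {P : Measure Ω}
    [IsProbabilityMeasure P] {a : ℕ → Ω → ℂ} {z : ℕ → ℂ} (ha_meas : ∀ k, Measurable (a k))
    (ha_ident : ∀ k, IdentDistrib (a k) (a 0) P P) {R : ℝ} {C : NNReal}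
    (hC : ∀ ζ : ℂ, ∫⁻ w in Metric.ball (0 : ℂ) R, ENNReal.ofReal ‖w - ζ‖⁻¹ ≤ C) {n : ℕ}
    (hn : 1 ≤ n) :
    ∫⁻ ω, (∫⁻ w in Metric.ball (0 : ℂ) R,
        ENNReal.ofReal (Real.log ‖ratSum (fun k => a k ω) z n w‖)) ∂P ≤
      ENNReal.ofReal (Real.log n) * volume (Metric.ball (0 : ℂ) R) + (∫⁻ ω, ‖a 0 ω‖ₑ ∂P) * C := by
  have hn0 : (0 : ℝ) < n := by exact_mod_cast hn
  have hlog : 0 ≤ Real.log n := Real.log_nonneg (by exact_mod_cast hn)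
  have hpt : ∀ ω w, ENNReal.ofReal (Real.log ‖ratSum (fun k => a k ω) z n w‖) ≤
      ENNReal.ofReal (Real.log n) + (n : ENNReal)⁻¹ *
        ∑ k ∈ Finset.range n, ‖a k ω‖ₑ * ENNReal.ofReal ‖w - z k‖⁻¹ := by
    intro ω w
    set x := ‖ratSum (fun k => a k ω) z n w‖ with hx
    have hxle : ENNReal.ofReal x ≤
        ∑ k ∈ Finset.range n, ‖a k ω‖ₑ * ENNReal.ofReal ‖w - z k‖⁻¹ := by
      rw [hx, ofReal_norm, ratSum]
      refine (enorm_sum_le _ _).trans (Finset.sum_le_sum fun k _ => ?_)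
      rw [← ofReal_norm, ← ofReal_norm, norm_div, div_eq_mul_inv,
        ENNReal.ofReal_mul (norm_nonneg _)]
    -- At `x = 0` this uses `Real.log 0 = 0`.
    have hlogx : Real.log x ≤ Real.log n + (n : ℝ)⁻¹ * x := by
      rcases (show 0 ≤ x from norm_nonneg _).eq_or_lt with h0 | h0
      · rw [← h0]; simpa using hlog
      · have := Real.log_le_self (show 0 ≤ x / n by positivity)
        rw [Real.log_div h0.ne' hn0.ne', div_eq_inv_mul] at this
        linarith
    refine (ENNReal.ofReal_le_ofReal hlogx).trans ?_
    rw [ENNReal.ofReal_add hlog (by positivity), ENNReal.ofReal_mul (by positivity),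
      ENNReal.ofReal_inv_of_pos hn0, ENNReal.ofReal_natCast]
    gcongr
  have hmean : ∀ k, ∫⁻ ω, ‖a k ω‖ₑ ∂P = ∫⁻ ω, ‖a 0 ω‖ₑ ∂P := fun k =>
    ((ha_ident k).comp measurable_enorm).lintegral_eq
  have hinner : ∀ ω, ∫⁻ w in Metric.ball (0 : ℂ) R,
      ENNReal.ofReal (Real.log ‖ratSum (fun k => a k ω) z n w‖) ≤
      ENNReal.ofReal (Real.log n) * volume (Metric.ball (0 : ℂ) R) +
        (n : ENNReal)⁻¹ * ∑ k ∈ Finset.range n, ‖a k ω‖ₑ * C := by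
    intro ω
    refine (lintegral_mono fun w => hpt ω w).trans ?_
    rw [lintegral_add_left measurable_const, setLIntegral_const,
      lintegral_const_mul' _ _ (by simpa using hn0.ne'), lintegral_finsetSum _
        (fun k _ => by fun_prop)]
    gcongr with k
    rw [lintegral_const_mul' _ _ enorm_ne_top]
    gcongr
    exact hC _
  refine (lintegral_mono hinner).trans ?_
  rw [lintegral_add_left measurable_const, lintegral_const, measure_univ, mul_one,
    lintegral_const_mul' _ _ (by simpa using hn0.ne'), lintegral_finsetSum _
      (fun k _ => by have := ha_meas k; fun_prop)]
  refine add_le_add le_rfl (le_of_eq ?_)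
  have hk : ∀ k, ∫⁻ ω, ‖a k ω‖ₑ * C ∂P = (∫⁻ ω, ‖a 0 ω‖ₑ ∂P) * C := fun k => by
    rw [lintegral_mul_const' _ _ ENNReal.coe_ne_top, hmean]
  simp_rw [hk]
  rw [Finset.sum_const, Finset.card_range, nsmul_eq_mul, ← mul_assoc,
    ENNReal.inv_mul_cancel (by simpa using hn0.ne') (by simp), one_mul]

lemma tendsto_measure_posPart_log_ratSum {Ω : Type*} [MeasurableSpace Ω] {P : Measure Ω}
    [IsProbabilityMeasure P] {a : ℕ → Ω → ℂ} (z : ℕ → ℂ) (ha_meas : ∀ k, Measurable (a k))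
    (ha_ident : ∀ k, IdentDistrib (a k) (a 0) P P) (ha_int : Integrable (a 0) P) (R : ℝ) {ε : ℝ}
    (hε : 0 < ε) :
    Tendsto (fun n : ℕ => P {ω | ENNReal.ofReal ε * n ≤ ∫⁻ w in Metric.ball (0 : ℂ) R,
        ENNReal.ofReal (Real.log ‖ratSum (fun k => a k ω) z n w‖)}) atTop (𝓝 0) := by
  obtain ⟨C, hC⟩ := exists_setLIntegral_inv_norm_sub_le R
  set E := ∫⁻ ω, ‖a 0 ω‖ₑ ∂P
  have hE : E ≠ ⊤ := ha_int.hasFiniteIntegral.ne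
  set V := volume (Metric.ball (0 : ℂ) R)
  have hV : V ≠ ⊤ := measure_ball_lt_top.ne
  have hbound : ∀ᶠ n : ℕ in atTop, P {ω | ENNReal.ofReal ε * n ≤ ∫⁻ w in Metric.ball (0 : ℂ) R,
        ENNReal.ofReal (Real.log ‖ratSum (fun k => a k ω) z n w‖)} ≤
      ENNReal.ofReal ((Real.log n * V.toReal + E.toReal * C) / (ε * n)) := by
    filter_upwards [eventually_ge_atTop 1] with n hn
    have hn0 : (0 : ℝ) < n := by exact_mod_cast hn
    have hlog : 0 ≤ Real.log n := Real.log_nonneg (by exact_mod_cast hn)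
    have hmeas : Measurable fun ω => ∫⁻ w in Metric.ball (0 : ℂ) R,
        ENNReal.ofReal (Real.log ‖ratSum (fun k => a k ω) z n w‖) :=
      Measurable.lintegral_prod_right' (f := fun p : Ω × ℂ =>
        ENNReal.ofReal (Real.log ‖ratSum (fun k => a k p.1) z n p.2‖))
        (measurable_uncurry_ratSum ha_meas z n).norm.log.ennreal_ofReal
    have hcast : ENNReal.ofReal ε * n = ENNReal.ofReal (ε * n) := by
      rw [ENNReal.ofReal_mul hε.le, ENNReal.ofReal_natCast]
    rw [hcast]
    refine (meas_ge_le_lintegral_div hmeas.aemeasurable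
      (ENNReal.ofReal_pos.2 (by positivity)).ne' ENNReal.ofReal_ne_top).trans ?_
    rw [ENNReal.ofReal_div_of_pos (by positivity)]
    gcongr
    refine (lintegral_setLIntegral_log_norm_ratSum_le ha_meas ha_ident hC hn).trans (le_of_eq ?_)
    rw [ENNReal.ofReal_add (by positivity) (by positivity), ENNReal.ofReal_mul hlog,
      ENNReal.ofReal_mul ENNReal.toReal_nonneg, ENNReal.ofReal_toReal hV, ENNReal.ofReal_toReal hE,
      ENNReal.ofReal_coe_nnreal]
  have hlim : Tendsto (fun n : ℕ => (Real.log n * V.toReal + E.toReal * C) / (ε * n)) atTop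
      (𝓝 0) := by
    have h1 : Tendsto (fun n : ℕ => Real.log n / n) atTop (𝓝 0) :=
      (Real.isLittleO_log_id_atTop.tendsto_div_nhds_zero).comp tendsto_natCast_atTop_atTop
    have h2 := tendsto_const_div_atTop_nhds_zero_nat (E.toReal * C)
    have h3 := ((h1.mul_const V.toReal).add h2).div_const ε
    simp only [zero_mul, zero_add, zero_div] at h3
    refine h3.congr fun n => ?_
    rw [div_mul_eq_mul_div, ← add_div, div_div, mul_comm ε]
  refine tendsto_of_tendsto_of_tendsto_of_le_of_le' tendsto_const_nhds ?_
    (Eventually.of_forall fun _ => zero_le) hbound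
  simpa using ENNReal.tendsto_ofReal hlim

/-- Convergence `(1/n) ∫_B |log |L_n|| → 0` in probability, on every disc `B` around `0` whose radius
is at least `|v|`. -/
lemma tendsto_measure_setLIntegral_abs_log_ratSum {Ω : Type*} [MeasurableSpace Ω] {P : Measure Ω}
    [IsProbabilityMeasure P] {a : ℕ → Ω → ℂ} {z : ℕ → ℂ} (ha_meas : ∀ k, Measurable (a k))
    (ha_ident : ∀ k, IdentDistrib (a k) (a 0) P P) (ha_int : Integrable (a 0) P)
    (hsmall : ∀ᵐ w : ℂ,
      Tendsto (fun n => P {ω | ‖ratSum (fun k => a k ω) z n w‖ < 1}) atTop (𝓝 0))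
    {v : ℂ} (hsmallv : Tendsto (fun n => P {ω | ‖ratSum (fun k => a k ω) z n v‖ < 1}) atTop (𝓝 0))
    {δ : ℝ} (hδ : 0 < δ) (hvz : ∀ k, δ ≤ ‖v - z k‖) {R : ℝ} (hv : ‖v‖ ≤ R) {ε : ℝ} (hε : 0 < ε) :
    Tendsto (fun n : ℕ => P {ω | ENNReal.ofReal ε * n ≤ ∫⁻ w in Metric.ball (0 : ℂ) R,
        ‖Real.log ‖ratSum (fun k => a k ω) z n w‖‖ₑ}) atTop (𝓝 0) := by
  obtain ⟨C, hC⟩ := exists_setLIntegral_inv_norm_sub_le R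
  have hR : 0 ≤ R := (norm_nonneg v).trans hv
  -- With these `M` and `D`, the zeros contribute at most `ε / 4`, and the other terms at most `ε / 4`
  -- if the area of `A n ω` is below `ε / 4 / D`.
  set M : ℝ := 1 + 8 * R * C / ε with hM
  have hM1 : 1 ≤ M := le_add_of_nonneg_right (by positivity)
  have hMC : 2 * R / M * C ≤ ε / 4 := by
    have : ε * M = ε + 8 * R * C := by rw [hM]; field_simp
    rw [div_mul_eq_mul_div, div_le_iff₀ (by linarith)]
    linarith
  set D : ℝ := 2 * R / δ + M
  have hD : 0 < D := by positivity
  set A : ℕ → Ω → Set ℂ := fun n ω => Metric.ball (0 : ℂ) R ∩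
    {w | ‖ratSum (fun k => a k ω) z n w‖ < 1}
  have hA : Tendsto (fun n => P {ω | ENNReal.ofReal (ε / 4 / D) ≤ volume (A n ω)}) atTop
      (𝓝 0) := by
    have hs : ENNReal.ofReal (ε / 4 / D) ≠ 0 := (ENNReal.ofReal_pos.2 (by positivity)).ne'
    have h1 := ENNReal.Tendsto.div_const
      (tendsto_lintegral_volume_norm_ratSum_lt_one ha_meas hsmall R) (Or.inr hs)
    rw [ENNReal.zero_div] at h1
    refine tendsto_of_tendsto_of_tendsto_of_le_of_le tendsto_const_nhds h1 (fun _ => zero_le)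
      fun n => meas_ge_le_lintegral_div ?_ hs ENNReal.ofReal_ne_top
    refine (measurable_measure_prodMk_left (ν := (volume : Measure ℂ))
      (s := {p : Ω × ℂ | p.2 ∈ Metric.ball (0 : ℂ) R} ∩
        {p : Ω × ℂ | ‖ratSum (fun k => a k p.1) z n p.2‖ < 1}) ?_).aemeasurable
    exact (measurable_snd Metric.isOpen_ball.measurableSet).inter
      (measurableSet_lt (measurable_uncurry_ratSum ha_meas z n).norm measurable_const)
  have hpos := tendsto_measure_posPart_log_ratSum z ha_meas ha_ident ha_int R (half_pos hε)
  have hsum := (hsmallv.add hA).add hpos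
  simp only [add_zero] at hsum
  refine tendsto_of_tendsto_of_tendsto_of_le_of_le tendsto_const_nhds hsum (fun _ => zero_le)
    fun n => ?_
  refine le_trans (measure_mono ?_) ((measure_union_le _ _).trans
    (add_le_add_left (measure_union_le _ _) _))
  intro ω hω
  -- Off the three exceptional events, each of the two parts of the integral is at most `n * ε / 2`,
  -- and the positive part is strictly smaller.
  by_contra hcon
  simp only [Set.mem_union, Set.mem_ofPred_eq, not_or, not_le, not_lt] at hcon hω
  obtain ⟨⟨hone, hAω⟩, hposω⟩ := hcon
  set L : ℂ → ℂ := ratSum (fun k => a k ω) z n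
  have hLmeas : Measurable L := (measurable_uncurry_ratSum ha_meas z n).comp measurable_prodMk_left
  have hneg : ∫⁻ w in Metric.ball (0 : ℂ) R, ENNReal.ofReal (-Real.log ‖L w‖) ≤
      ENNReal.ofReal (ε / 2) * n := by
    have h1 : ∫⁻ w in Metric.ball (0 : ℂ) R, ENNReal.ofReal (-Real.log ‖L w‖) =
        ∫⁻ w in A n ω, ENNReal.ofReal (-Real.log ‖L w‖) := by
      have hset : MeasurableSet {w | ‖L w‖ < 1} := measurableSet_lt hLmeas.norm measurable_const
      rw [← lintegral_inter_add_sdiff _ (Metric.ball (0 : ℂ) R) hset]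
      simp only [A]
      rw [setLIntegral_eq_zero (Metric.isOpen_ball.measurableSet.diff hset), add_zero]
      intro w hw
      have : 1 ≤ ‖L w‖ := by simpa using hw.2
      simpa using Real.log_nonneg this
    rw [h1]
    refine (setLIntegral_neg_log_norm_ratSum_le hC hδ hM1 hvz hv hone
      Set.inter_subset_left).trans ?_
    rw [mul_comm]
    gcongr
    calc ENNReal.ofReal D * volume (A n ω) + ENNReal.ofReal (2 * R / M) * C
        ≤ ENNReal.ofReal D * ENNReal.ofReal (ε / 4 / D) + ENNReal.ofReal (2 * R / M) * C := by
          gcongr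
      _ = ENNReal.ofReal (ε / 4) + ENNReal.ofReal (2 * R / M * C) := by
          rw [← ENNReal.ofReal_mul hD.le, mul_div_cancel₀ _ hD.ne',
            ENNReal.ofReal_mul (by positivity), ENNReal.ofReal_coe_nnreal]
      _ ≤ ENNReal.ofReal (ε / 4) + ENNReal.ofReal (ε / 4) := by gcongr
      _ = ENNReal.ofReal (ε / 2) := by
          rw [← ENNReal.ofReal_add (by positivity) (by positivity)]; ring_nf
  have habs : ∫⁻ w in Metric.ball (0 : ℂ) R, ‖Real.log ‖L w‖‖ₑ =
      (∫⁻ w in Metric.ball (0 : ℂ) R, ENNReal.ofReal (Real.log ‖L w‖)) +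
      ∫⁻ w in Metric.ball (0 : ℂ) R, ENNReal.ofReal (-Real.log ‖L w‖) := by
    rw [← lintegral_add_left hLmeas.norm.log.ennreal_ofReal]
    refine lintegral_congr fun w => ?_
    rw [Real.enorm_eq_ofReal_abs]
    rcases le_total 0 (Real.log ‖L w‖) with h | h
    · rw [abs_of_nonneg h, ENNReal.ofReal_of_nonpos (neg_nonpos.2 h), add_zero]
    · rw [abs_of_nonpos h, ENNReal.ofReal_of_nonpos h, zero_add]
  have hlt := ENNReal.add_lt_add_of_lt_of_le
    (ne_top_of_le_ne_top (ENNReal.mul_ne_top ENNReal.ofReal_ne_top (ENNReal.natCast_ne_top n)) hneg)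
    hposω hneg
  rw [← habs, ← add_mul, ← ENNReal.ofReal_add (by positivity) (by positivity), add_halves] at hlt
  exact hlt.not_ge hω

/-- Here `ψ` is the Laplacian of `f`: the two sign changes from integrating by parts cancel. -/
lemma exists_test_function_smul_distLaplacian_eq (f : 𝓓((⊤ : TopologicalSpace.Opens ℂ), ℝ)) :
    ∃ ψ : 𝓓((⊤ : TopologicalSpace.Opens ℂ), ℝ), ∀ (u : ℂ → ℝ) (c : ℝ), LocallyIntegrable u volume →
      (c • distLaplacian (regularDistribution u)) f = c * ∫ w, ψ w * u w := by
  refine ⟨∂_{(1 : ℂ)} (∂_{(1 : ℂ)} f) + ∂_{Complex.I} (∂_{Complex.I} f), fun u c hu => ?_⟩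
  have h1 : (c • distLaplacian (regularDistribution u)) f =
      c * regularDistribution u (∂_{(1 : ℂ)} (∂_{(1 : ℂ)} f) + ∂_{Complex.I} (∂_{Complex.I} f)) := by
    have h2 : distLaplacian (regularDistribution u) f =
        regularDistribution u (∂_{(1 : ℂ)} (∂_{(1 : ℂ)} f) + ∂_{Complex.I} (∂_{Complex.I} f)) := by
      rw [map_add]
      change (∂_{(1 : ℂ)} (∂_{(1 : ℂ)} (regularDistribution u))) f +
        (∂_{Complex.I} (∂_{Complex.I} (regularDistribution u))) f = _
      simp only [Distribution.lineDerivOp_apply_apply, LineDeriv.lineDerivOp_neg, neg_neg]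
    rw [← h2]; rfl
  have h3 : ∀ g : 𝓓((⊤ : TopologicalSpace.Opens ℂ), ℝ),
      regularDistribution u g = ∫ w, g w * u w := fun g =>
    TestFunction.integralAgainstBilinCLM_eq_integral (hu.locallyIntegrableOn _)
  rw [h1, h3]

/-- A property that holds almost everywhere holds at some point whose distance to the whole sequence
is positive, as soon as some point is not a limit point of the sequence. -/
lemma exists_forall_le_norm_sub_of_not_mapClusterPt {z : ℕ → ℂ} {p : ℂ → Prop}
    (hp : ∀ᵐ w : ℂ, p w) (hz : ∃ w₀ : ℂ, ¬ MapClusterPt w₀ atTop z) :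
    ∃ (v : ℂ) (δ : ℝ), p v ∧ 0 < δ ∧ ∀ k, δ ≤ ‖v - z k‖ := by
  obtain ⟨w₀, hw₀⟩ := hz
  simp only [mapClusterPt_iff_frequently, not_forall, not_frequently] at hw₀
  obtain ⟨U, hU, hzU⟩ := hw₀
  obtain ⟨r, hr, hrU⟩ := Metric.mem_nhds_iff.1 hU
  obtain ⟨N, hN⟩ := eventually_atTop.1 hzU
  have hpos : volume (Metric.ball w₀ (r / 2)) ≠ 0 := (Metric.measure_ball_pos _ _ (half_pos hr)).ne'
  obtain ⟨v, hv, hpv, hvz⟩ := (frequently_ae_mem_iff.2 hpos).and_eventually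
    (hp.and (ae_forall_ne_of_countable z)) |>.exists
  have hfin : ∃ δ > 0, ∀ k ∈ Finset.range N, δ ≤ ‖v - z k‖ := by
    clear hN
    induction N with
    | zero => exact ⟨1, one_pos, by simp⟩
    | succ N ih =>
      obtain ⟨δ, hδ, h⟩ := ih
      refine ⟨min δ ‖v - z N‖, lt_min hδ (norm_pos_iff.2 (sub_ne_zero.2 (hvz N))), fun k hk => ?_⟩
      rcases Nat.lt_succ_iff_lt_or_eq.1 (Finset.mem_range.1 hk) with hk | rfl
      · exact (min_le_left _ _).trans (h k (Finset.mem_range.2 hk))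
      · exact min_le_right _ _
  obtain ⟨δ, hδ, h⟩ := hfin
  refine ⟨v, min δ (r / 2), hpv, lt_min hδ (half_pos hr), fun k => ?_⟩
  by_cases hk : k < N
  · exact (min_le_left _ _).trans (h k (Finset.mem_range.2 hk))
  · refine (min_le_right _ _).trans (not_lt.1 fun hlt => hN k (not_lt.1 hk) (hrU ?_))
    rw [Metric.mem_ball] at hv ⊢
    rw [← dist_eq_norm, dist_comm] at hlt
    linarith [dist_triangle (z k) v w₀]

theorem theorem2p3p7 {Ω : Type*} [MeasurableSpace Ω] (P : Measure Ω) [IsProbabilityMeasure P]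
    (a : ℕ → Ω → ℂ) (z : ℕ → ℂ)
    -- the `a k` are i.i.d., integrable, and not almost surely constant
    (ha_meas : ∀ k, Measurable (a k))
    (ha_indep : iIndepFun a P)
    (ha_ident : ∀ k, IdentDistrib (a k) (a 0) P P)
    (ha_int : Integrable (a 0) P)
    (ha_nondeg : ¬ ∃ c : ℂ, ∀ᵐ ω ∂P, a 0 ω = c)
    -- for a.e. `w`, infinitely many `z k` lie in a compact set at positive distance from `w`
    (hz_compact : ∀ᵐ w : ℂ, ∃ K : Set ℂ,
      IsCompact K ∧ 0 < Metric.infDist w K ∧ {k : ℕ | z k ∈ K}.Infinite)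
    -- some point is not a limit point of the sequence
    (hz_limit : ∃ w₀ : ℂ, ¬ MapClusterPt w₀ atTop z) :
    -- `log |L_n|` is locally integrable, hence a distribution, unless `L_n` vanishes identically
    (∀ n ω, ¬ (ratSum (fun k => a k ω) z n =ᵐ[volume] 0) →
      LocallyIntegrable (fun w : ℂ => Real.log ‖ratSum (fun k => a k ω) z n w‖) volume) ∧
    -- the exceptional event has probability tending to zero
    Tendsto (fun n => P {ω | ratSum (fun k => a k ω) z n =ᵐ[volume] 0}) atTop (𝓝 0) ∧
    -- tested against every test function, `(1 / n) Δ log |L_n|` tends to `0` in probability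
    ∀ f : 𝓓((⊤ : TopologicalSpace.Opens ℂ), ℝ),
      TendstoInMeasure P
        (fun (n : ℕ) (ω : Ω) =>
          ((1 / (n : ℝ)) • distLaplacian (regularDistribution
            (fun w : ℂ => Real.log ‖ratSum (fun k => a k ω) z n w‖))) f)
        atTop (fun _ => 0) := by
  have hsmall := ae_tendsto_measure_norm_ratSum_lt_one ha_meas ha_indep ha_ident ha_nondeg
    hz_compact
  obtain ⟨v, δ, hsmallv, hδ, hvz⟩ :=
    exists_forall_le_norm_sub_of_not_mapClusterPt hsmall hz_limit
  refine ⟨fun n ω _ => locallyIntegrable_log_norm_ratSum _ z n, ?_, fun f => ?_⟩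
  · refine tendsto_of_tendsto_of_tendsto_of_le_of_le tendsto_const_nhds hsmallv
      (fun _ => zero_le) fun n => measure_mono fun ω hω => ?_
    have hvne : ∀ k, v ≠ z k := fun k hk => by
      have := hvz k
      rw [hk, sub_self, norm_zero] at this
      linarith
    simp [ratSum_eq_zero_of_ae_eq_zero hω hvne]
  · obtain ⟨ψ, hψ⟩ := exists_test_function_smul_distLaplacian_eq f
    obtain ⟨B, hB⟩ := ψ.hasCompactSupport.exists_bound_of_continuous ψ.continuous
    obtain ⟨r, hr⟩ := (Metric.isBounded_iff_subset_ball (0 : ℂ)).1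
      ψ.hasCompactSupport.isCompact.isBounded
    set R := max r ‖v‖
    have hsupp : ∀ w, w ∉ Metric.ball (0 : ℂ) R → ψ w = 0 := fun w hw =>
      image_eq_zero_of_notMem_tsupport fun h =>
        hw (Metric.ball_subset_ball (le_max_left _ _) (hr h))
    set M := max B 1
    have hM : 0 < M := lt_max_of_lt_right one_pos
    rw [tendstoInMeasure_iff_norm]
    intro ε hε
    have hlim := tendsto_measure_setLIntegral_abs_log_ratSum ha_meas ha_ident ha_int hsmall hsmallv
      hδ hvz (le_max_right r ‖v‖) (div_pos hε hM)
    refine tendsto_of_tendsto_of_tendsto_of_le_of_le' tendsto_const_nhds hlim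
      (Eventually.of_forall fun _ => zero_le) ?_
    filter_upwards [eventually_ge_atTop 1] with n hn
    have hn0 : (0 : ℝ) < n := by exact_mod_cast hn
    refine measure_mono fun ω hω => ?_
    simp only [Set.mem_ofPred_eq, sub_zero] at hω ⊢
    set u : ℂ → ℝ := fun w => Real.log ‖ratSum (fun k => a k ω) z n w‖
    rw [hψ u _ (locallyIntegrable_log_norm_ratSum _ z n)] at hω
    have hnorm : ‖∫ w, ψ w * u w‖ₑ ≤ ENNReal.ofReal M *
        ∫⁻ w in Metric.ball (0 : ℂ) R, ‖u w‖ₑ := by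
      rw [← setIntegral_eq_integral_of_forall_compl_eq_zero (s := Metric.ball (0 : ℂ) R)
        (fun w hw => by rw [hsupp w hw, zero_mul])]
      refine (enorm_integral_le_lintegral_enorm _).trans ?_
      rw [← lintegral_const_mul' _ _ ENNReal.ofReal_ne_top]
      refine lintegral_mono fun w => ?_
      rw [enorm_mul]
      gcongr
      rw [← ofReal_norm]
      exact ENNReal.ofReal_le_ofReal ((hB w).trans (le_max_left _ _))
    have hint : ε * n ≤ ‖∫ w, ψ w * u w‖ := by
      rw [norm_mul, Real.norm_of_nonneg (by positivity), one_div, ← div_eq_inv_mul,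
        le_div_iff₀ hn0] at hω
      exact hω
    have hle : ENNReal.ofReal (ε * n) ≤ ENNReal.ofReal M *
        ∫⁻ w in Metric.ball (0 : ℂ) R, ‖u w‖ₑ :=
      ((ENNReal.ofReal_le_ofReal hint).trans_eq (ofReal_norm _)).trans hnorm
    rw [← ENNReal.ofReal_natCast n, ← ENNReal.ofReal_mul (by positivity), div_mul_eq_mul_div,
      ENNReal.ofReal_div_of_pos hM]
    exact ENNReal.div_le_of_le_mul' hle
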